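/- Let $G$ be a simple graph embedded in the Euclidean plane (vertices are distinct points, edges are simple arcs joining their end vertices, no arc contains a vertex other than its end vertices, and two different arcs meet only at common end vertices). For a cycle $C$ of $G$, a vertex of $G$ is inside (respectively outside) $C$ if it does not lie on the closed curve formed by the arcs of the edges of $C$ and lies in a bounded (respectively unbounded) connected component of the complement of that curve in the plane. Let $X$ and $Y$ be cycles in $G$ and let $x$ be a vertex of $G$ with $x\notin V(X)\cup V(Y)$. If $x$ is adjacent to every vertex of $X$ and to every vertex of $Y$, then $X$ does not have both a vertex inside $Y$ and a vertex outside $Y$. -/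

import Mathlib

/-- The Euclidean plane. -/
abbrev Plane : Type := EuclideanSpace ℝ (Fin 2)

/-- An embedding of a simple graph in the plane: vertices are distinct points, each edge is a simple
arc joining its end vertices, no other vertex lies on the arc, and two different arcs meet only at
common end vertices. The values of `arc` at non-edges are irrelevant. -/
structure PlaneEmbedding {V : Type*} (G : SimpleGraph V) where
  /-- the point that represents a vertex -/
  point : V → Plane
  /-- the point set of the curve that represents an edge -/
  arc : Sym2 V → Set Plane
  point_injective : Function.Injective point
  isArc : ∀ u v : V, G.Adj u v →
    ∃ γ : Path (point u) (point v), Function.Injective γ ∧ Set.range γ = arc s(u, v)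
  mem_of_point_mem_arc : ∀ e ∈ G.edgeSet, ∀ w : V, point w ∈ arc e → w ∈ e
  arc_inter : ∀ e ∈ G.edgeSet, ∀ f ∈ G.edgeSet, e ≠ f →
    ∀ z ∈ arc e ∩ arc f, ∃ w : V, w ∈ e ∧ w ∈ f ∧ point w = z

namespace PlaneEmbedding

variable {V : Type*} {G : SimpleGraph V}

/-- The closed curve traced by a closed walk (in particular by a cycle): the union of the arcs of
its edges. -/
def curve (D : PlaneEmbedding G) {a : V} (C : G.Walk a a) : Set Plane :=
  {z | ∃ e ∈ C.edges, z ∈ D.arc e}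

/-- The vertex `v` lies (strictly) inside `C`: it is not on the curve of `C`, and it lies in a
bounded connected component of the complement of that curve. -/
def IsInside (D : PlaneEmbedding G) {a : V} (C : G.Walk a a) (v : V) : Prop :=
  D.point v ∉ D.curve C ∧
    Bornology.IsBounded (connectedComponentIn (D.curve C)ᶜ (D.point v))

/-- The vertex `v` lies (strictly) outside `C`: it is not on the curve of `C`, and it lies in an
unbounded connected component of the complement of that curve. -/
def IsOutside (D : PlaneEmbedding G) {a : V} (C : G.Walk a a) (v : V) : Prop :=
  D.point v ∉ D.curve C ∧
    ¬ Bornology.IsBounded (connectedComponentIn (D.curve C)ᶜ (D.point v))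

end PlaneEmbedding

/- An arc can meet the curve of `C` only in common end vertices, so an edge whose end vertices are
both off the curve joins them within one component of the complement. A vertex off `Y` thus shares
its component with each of its neighbours off the curve of `Y`, so these cannot lie on both
sides. -/

namespace PlaneEmbedding

variable {V : Type*} {G : SimpleGraph V} (D : PlaneEmbedding G)

theorem isPreconnected_arc {e : Sym2 V} (he : e ∈ G.edgeSet) : IsPreconnected (D.arc e) := by
  induction e with | h u v =>
  obtain ⟨γ, -, hγ⟩ := D.isArc u v he
  exact hγ ▸ isPreconnected_range γ.continuous

theorem point_mem_arc {e : Sym2 V} (he : e ∈ G.edgeSet) {v : V} (hv : v ∈ e) :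
    D.point v ∈ D.arc e := by
  obtain ⟨w, rfl⟩ := hv
  obtain ⟨γ, -, hγ⟩ := D.isArc v w he
  exact hγ ▸ ⟨0, γ.source⟩

variable {a : V} {C : G.Walk a a}

theorem point_notMem_curve {v : V} (hv : v ∉ C.support) : D.point v ∉ D.curve C := by
  rintro ⟨e, he, hve⟩
  exact hv (C.mem_support_of_mem_edges he
    (D.mem_of_point_mem_arc e (C.edges_subset_edgeSet he) v hve))

theorem disjoint_arc_curve {e : Sym2 V} (he : e ∈ G.edgeSet)
    (h_off : ∀ v ∈ e, D.point v ∉ D.curve C) : Disjoint (D.arc e) (D.curve C) := by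
  rw [Set.disjoint_left]
  rintro z hze ⟨f, hfC, hzf⟩
  have hf : f ∈ G.edgeSet := C.edges_subset_edgeSet hfC
  have hef : e ≠ f := by
    rintro rfl
    exact h_off _ e.out_fst_mem ⟨e, hfC, D.point_mem_arc he e.out_fst_mem⟩
  obtain ⟨w, hwe, -, rfl⟩ := D.arc_inter e he f hf hef z ⟨hze, hzf⟩
  exact h_off w hwe ⟨f, hfC, hzf⟩

theorem connectedComponentIn_compl_curve_eq_of_adj {u v : V} (huv : G.Adj u v)
    (hu : D.point u ∉ D.curve C) (hv : D.point v ∉ D.curve C) :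
    connectedComponentIn (D.curve C)ᶜ (D.point u) =
      connectedComponentIn (D.curve C)ᶜ (D.point v) := by
  have h_arc : D.arc s(u, v) ⊆ (D.curve C)ᶜ :=
    (D.disjoint_arc_curve huv (Sym2.ball.2 ⟨hu, hv⟩)).subset_compl_right
  have hu_arc : D.point u ∈ D.arc s(u, v) := D.point_mem_arc huv (Sym2.mem_mk_left u v)
  have hv_arc : D.point v ∈ D.arc s(u, v) := D.point_mem_arc huv (Sym2.mem_mk_right u v)
  exact connectedComponentIn_eq
    ((D.isPreconnected_arc huv).subset_connectedComponentIn hu_arc h_arc hv_arc)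

end PlaneEmbedding

theorem theorem2_general {V : Type*} {G : SimpleGraph V} (D : PlaneEmbedding G) {b x u v : V}
    {Y : G.Walk b b} (hx : x ∉ Y.support) (hxu : G.Adj x u) (hxv : G.Adj x v) :
    ¬ (D.IsInside Y u ∧ D.IsOutside Y v) := by
  rintro ⟨⟨hu_off, hu_bdd⟩, hv_off, hv_unbdd⟩
  have hx_off : D.point x ∉ D.curve Y := D.point_notMem_curve hx
  rw [← D.connectedComponentIn_compl_curve_eq_of_adj hxu hx_off hu_off] at hu_bdd
  rw [← D.connectedComponentIn_compl_curve_eq_of_adj hxv hx_off hv_off] at hv_unbdd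
  exact hv_unbdd hu_bdd

theorem theorem2 {V : Type*} (G : SimpleGraph V) (D : PlaneEmbedding G)
    {a b : V} (X : G.Walk a a) (Y : G.Walk b b) (hX : X.IsCycle) (hY : Y.IsCycle)
    (x : V) (hx : x ∉ {v | v ∈ X.support} ∪ {v | v ∈ Y.support})
    (hadjX : ∀ v ∈ X.support, G.Adj x v) (hadjY : ∀ v ∈ Y.support, G.Adj x v) :
    ¬ ((∃ u ∈ X.support, D.IsInside Y u) ∧ (∃ v ∈ X.support, D.IsOutside Y v)) := by
  rintro ⟨⟨u, hu, hu_in⟩, v, hv, hv_out⟩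
  exact theorem2_general D (fun h => hx (Or.inr h)) (hadjX u hu) (hadjX v hv) ⟨hu_in, hv_out⟩
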